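/- Let $1\ge p>q\ge 0$, $w_p>0$, $0<\gamma<1$ and $w_q=\gamma w_p$. For a partition $(\mathcal I_a,\mathcal I_b)$ of $\{1,\dots,n\}$, the two-community weighted stochastic block model is the random symmetric $n\times n$ matrix $A$ whose entries $A_{ij}$, $1\le i\le j\le n$, are independent, where $A_{ij}$ equals $w_p$ with probability $p$ and $0$ with probability $1-p$ if $i,j$ lie in the same part, and equals $w_q$ with probability $q$ and $0$ with probability $1-q$ otherwise; $A_{ji}=A_{ij}$. Put $n_{\min}=\min\{|\mathcal I_a|,|\mathcal I_b|\}$. For a symmetric matrix $M$ let $L_M=\mathrm{diag}(M\mathbf 1)-M$, let $\lambda_k(L_M)$ be the $k$-th smallest eigenvalue of $L_M$ (counted with multiplicity), and let $v_2(L_M)$ be a unit eigenvector of $L_M$ for $\lambda_2(L_M)$ that is orthogonal to $\mathbf 1$ (the eigendecomposition being taken with $v_1=\mathbf 1/\sqrt n$). Suppose $n_{\min}=\Omega(n)$, that is, $n_{\min}\ge c\,n$ for a fixed constant $c>0$, and let $0<\delta<1$. Then there is $N$ (depending only on $p,q,w_p,\gamma,c,\delta$) such that for all $n\ge N$ and every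 partition $(\mathcal I_a,\mathcal I_b)$ of $\{1,\dots,n\}$ with $n_{\min}\ge cn$, with probability at least $1-\delta$ both of the following hold: 1. $\displaystyle \lambda_3(L_A)\ \ge\ w_p(p+\gamma q)\,n_{\min}-8w_p\sqrt{np\log(4n/\delta)}$; 2. $\displaystyle \sin\big(v_2(L_A),v_2(L_{\mathbb E A})\big)\ \le\ \frac{16\sqrt2}{p-\gamma q}\sqrt{\frac{np\log(4n/\delta)}{n_{\min}^2}}$ for every admissible choice of $v_2(L_A)$ and $v_2(L_{\mathbb E A})$, where $\sin(u,v)=\sqrt{1-|u^{T}v|^2}$. -/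

import Mathlib

open MeasureTheory ProbabilityTheory
open scoped Matrix

/-- The Laplacian `L_A = D_A - A`, `D_A = diag (A 𝟙)`, of a weighted adjacency matrix `A`. -/
def laplacian {n : ℕ} (A : Matrix (Fin n) (Fin n) ℝ) : Matrix (Fin n) (Fin n) ℝ :=
  Matrix.diagonal (A *ᵥ 1) - A

open Classical in
/-- The `k`-th smallest eigenvalue `λ_k(M)`, `1 ≤ k ≤ n`, of a real symmetric `n × n` matrix,
eigenvalues being counted with multiplicity (`0` when `M` is not symmetric or `k` is out of range).
Mathlib's `eigenvalues₀` lists the eigenvalues in decreasing order, starting from index `0`. -/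
noncomputable def kthEigenvalue {n : ℕ} (M : Matrix (Fin n) (Fin n) ℝ) (k : ℕ) : ℝ :=
  if h : M.IsHermitian ∧ 1 ≤ k ∧ k ≤ n then
    h.1.eigenvalues₀ ⟨n - k, by rw [Fintype.card_fin]; omega⟩
  else 0

/-- `v` is an admissible choice of the second eigenvector `v_2(L)` of a Laplacian matrix `L`:
the eigendecomposition is taken with `v_1(L) = 𝟙 / √n`, so `v_2(L)` is a unit eigenvector for
`λ_2(L)` that is orthogonal to `𝟙`. -/
structure IsSecondEigenvector {n : ℕ} (L : Matrix (Fin n) (Fin n) ℝ) (v : Fin n → ℝ) : Prop where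
  unit : v ⬝ᵥ v = 1
  orthogonal : v ⬝ᵥ 1 = 0
  eigen : L *ᵥ v = kthEigenvalue L 2 • v

/-- The sine `√(1 - |uᵀ v|²)` of the angle between (the lines spanned by) two unit vectors. -/
noncomputable def sinAngle {n : ℕ} (u v : Fin n → ℝ) : ℝ :=
  Real.sqrt (1 - |u ⬝ᵥ v| ^ 2)

/-- `A` is a random symmetric matrix whose entries `A_ij`, `i ≤ j`, are independent, with
`A_ij = W_ij` with probability `P_ij` and `A_ij = 0` with probability `1 - P_ij`. -/
structure IsRandomWeightedGraph {Ω : Type*} [MeasurableSpace Ω] (μ : Measure Ω) {n : ℕ}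
    (P W : Matrix (Fin n) (Fin n) ℝ) (A : Ω → Matrix (Fin n) (Fin n) ℝ) : Prop where
  symm : ∀ ω i j, A ω j i = A ω i j
  measurable : ∀ i j, Measurable fun ω => A ω i j
  indep : iIndepFun (fun (e : {e : Fin n × Fin n // e.1 ≤ e.2}) ω => A ω e.1.1 e.1.2) μ
  law : ∀ i j, i ≤ j → μ.map (fun ω => A ω i j) =
    ENNReal.ofReal (P i j) • Measure.dirac (W i j) + ENNReal.ofReal (1 - P i j) • Measure.dirac 0

/-- The two-community block matrix with value `x` inside the communities `Ia`, `Iaᶜ`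
and value `y` between them. -/
def twoBlock {n : ℕ} (Ia : Finset (Fin n)) (x y : ℝ) : Matrix (Fin n) (Fin n) ℝ :=
  Matrix.of fun i j => if i ∈ Ia ↔ j ∈ Ia then x else y

/-- The weighted stochastic block model with two communities `(Ia, Ib, p, q, w_p, w_q)`. -/
structure IsWSBM {Ω : Type*} [MeasurableSpace Ω] (μ : Measure Ω) {n : ℕ}
    (Ia Ib : Finset (Fin n)) (p q wp wq : ℝ) (A : Ω → Matrix (Fin n) (Fin n) ℝ) : Prop where
  partition : IsCompl Ia Ib
  graph : IsRandomWeightedGraph μ (twoBlock Ia p q) (twoBlock Ia wp wq) A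

/-- The entrywise expectation `𝔼 A` of a random matrix. -/
noncomputable def expectedMatrix {Ω : Type*} [MeasurableSpace Ω] (μ : Measure Ω) {n : ℕ}
    (A : Ω → Matrix (Fin n) (Fin n) ℝ) : Matrix (Fin n) (Fin n) ℝ :=
  Matrix.of fun i j => ∫ ω, A ω i j ∂μ

theorem laplacian_mulVec_one {n : ℕ} (A : Matrix (Fin n) (Fin n) ℝ) : laplacian A *ᵥ 1 = 0 := by
  ext i
  simp [laplacian, Matrix.sub_mulVec, Matrix.mulVec_diagonal]

theorem laplacian_isHermitian {n : ℕ} {A : Matrix (Fin n) (Fin n) ℝ}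
    (hA : ∀ i j, A j i = A i j) : (laplacian A).IsHermitian := by
  ext i j
  by_cases h : i = j
  · subst h; simp [laplacian]
  · simp [laplacian, h, Ne.symm h, hA]

theorem laplacian_nonneg {n : ℕ} {A : Matrix (Fin n) (Fin n) ℝ}
    (hA : ∀ i j, A j i = A i j) (hA0 : ∀ i j, 0 ≤ A i j) (x : Fin n → ℝ) :
    0 ≤ x ⬝ᵥ (laplacian A *ᵥ x) := by
  have e1 : x ⬝ᵥ (laplacian A *ᵥ x) = ∑ i, ∑ j, (A i j * x i ^ 2 - A i j * (x i * x j)) := by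
    rw [laplacian, Matrix.sub_mulVec]
    simp only [dotProduct, Pi.sub_apply, Matrix.mulVec_diagonal]
    simp only [Matrix.mulVec, dotProduct, Pi.one_apply, mul_one, Finset.sum_sub_distrib, mul_sub,
      Finset.sum_mul, Finset.mul_sum]
    congr 1
    · refine Finset.sum_congr rfl fun i _ => Finset.sum_congr rfl fun j _ => by ring
    · refine Finset.sum_congr rfl fun i _ => Finset.sum_congr rfl fun j _ => by ring
  have e2 : x ⬝ᵥ (laplacian A *ᵥ x) = ∑ i, ∑ j, (A i j * x j ^ 2 - A i j * (x i * x j)) := by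
    rw [e1, Finset.sum_comm]
    refine Finset.sum_congr rfl fun i _ => Finset.sum_congr rfl fun j _ => by rw [hA i j]; ring
  have e3 : 0 ≤ ∑ i, ∑ j, A i j * (x i - x j) ^ 2 :=
    Finset.sum_nonneg fun i _ => Finset.sum_nonneg fun j _ => mul_nonneg (hA0 i j) (sq_nonneg _)
  have e4 : ∑ i, ∑ j, A i j * (x i - x j) ^ 2 =
      (∑ i, ∑ j, (A i j * x i ^ 2 - A i j * (x i * x j))) +
      ∑ i, ∑ j, (A i j * x j ^ 2 - A i j * (x i * x j)) := by
    simp only [← Finset.sum_add_distrib]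
    refine Finset.sum_congr rfl fun i _ => Finset.sum_congr rfl fun j _ => by ring
  linarith

/-- The second eigenvector exists for every Laplacian with nonnegative symmetric weights. -/
theorem exists_isSecondEigenvector {n : ℕ} (hn : 2 ≤ n) {A : Matrix (Fin n) (Fin n) ℝ}
    (hA : ∀ i j, A j i = A i j) (hA0 : ∀ i j, 0 ≤ A i j) :
    ∃ v, IsSecondEigenvector (laplacian A) v := by
  have hL := laplacian_isHermitian hA
  have hsymm : ∀ v : Fin n → ℝ, (laplacian A *ᵥ v) ⬝ᵥ 1 = 0 := fun v => by
    have ht : (laplacian A)ᵀ = laplacian A := by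
      simpa [Matrix.IsHermitian, Matrix.conjTranspose_eq_transpose_of_trivial] using hL
    rw [dotProduct_comm, Matrix.dotProduct_mulVec, ← Matrix.mulVec_transpose, ht,
      laplacian_mulVec_one, zero_dotProduct]
  have key : ∀ k : Fin (Fintype.card (Fin n)), ∃ i : Fin n, hL.eigenvalues i = hL.eigenvalues₀ k ∧
      (Fintype.equivOfCardEq (Fintype.card_fin _)).symm i = k := fun k =>
    ⟨Fintype.equivOfCardEq (Fintype.card_fin _) k, by
      simp [Matrix.IsHermitian.eigenvalues], by simp⟩
  obtain ⟨i, hi, hi'⟩ := key ⟨n - 2, by rw [Fintype.card_fin]; omega⟩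
  obtain ⟨j, hj, hj'⟩ := key ⟨n - 1, by rw [Fintype.card_fin]; omega⟩
  have hij : i ≠ j := by
    rintro rfl
    rw [hi'] at hj'
    simp at hj'
    omega
  have hk : kthEigenvalue (laplacian A) 2 = hL.eigenvalues i := by
    rw [hi, kthEigenvalue, dif_pos ⟨hL, by norm_num, hn⟩]
  have hle : hL.eigenvalues j ≤ hL.eigenvalues i := by
    rw [hi, hj]
    apply hL.eigenvalues₀_antitone
    simp only [Fin.mk_le_mk]; omega
  have hev := hL.mulVec_eigenvectorBasis
  set b := hL.eigenvectorBasis with hb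
  have hdot : ∀ k l, (b k).ofLp ⬝ᵥ (b l).ofLp = if k = l then 1 else 0 := fun k l => by
    have := orthonormal_iff_ite.mp b.orthonormal l k
    simp only [EuclideanSpace.inner_eq_star_dotProduct, star_trivial] at this
    rw [this]
    simp [eq_comm]
  by_cases h0 : hL.eigenvalues i = 0
  · have hj0 : hL.eigenvalues j = 0 := by
      have h1 := laplacian_nonneg hA hA0 (b j).ofLp
      rw [hev j, dotProduct_smul, hdot j j] at h1
      simp at h1
      linarith
    by_cases hs : (b i).ofLp ⬝ᵥ 1 = 0
    · exact ⟨(b i).ofLp, by simp [hdot], hs, by rw [hk]; exact hev i⟩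
    · set s := (b i).ofLp ⬝ᵥ (1 : Fin n → ℝ)
      set t := (b j).ofLp ⬝ᵥ (1 : Fin n → ℝ)
      have hr : 0 < t ^ 2 + s ^ 2 := by positivity
      have hr2 := Real.sq_sqrt hr.le
      have hr3 := Real.sqrt_pos.mpr hr
      refine ⟨(Real.sqrt (t ^ 2 + s ^ 2))⁻¹ • (t • (b i).ofLp - s • (b j).ofLp), ?_, ?_, ?_⟩
      · simp only [smul_dotProduct, dotProduct_smul, sub_dotProduct, dotProduct_sub, hdot, hij,
          hij.symm, smul_eq_mul, if_true, if_false]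
        field_simp
        linarith
      · simp only [smul_dotProduct, sub_dotProduct, smul_eq_mul]
        change _ * (t * s - s * t) = 0
        ring
      · rw [Matrix.mulVec_smul, Matrix.mulVec_sub, Matrix.mulVec_smul, Matrix.mulVec_smul, hev, hev,
          hk, h0, hj0]
        simp
  · refine ⟨(b i).ofLp, by simp [hdot], ?_, by rw [hk]; exact hev i⟩
    have := hsymm (b i).ofLp
    rw [hev i, smul_dotProduct, smul_eq_mul] at this
    exact (mul_eq_zero.mp this).resolve_left h0

/-! Write ε = 8 w_p √(n p l) with l = log(4n/δ). The proof combines a deterministic perturbation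
argument with the bound ‖L_A − L_{𝔼A}‖ ≤ ε, which holds with probability at least 1 − δ.

Deterministic half. `𝔼 A` is a two-block matrix with values a = p w_p and b = q w_q. Its Laplacian
kills 𝟙, multiplies the community vector by nb, and has quadratic form at least nb + g on their
orthogonal complement, where g = (a − b) n_min. Courant–Fischer then gives λ₃(L_A) ≥ nb + g − ε and
λ₂(L_A) ≤ nb + ε. The first is claim 1, as n ≥ 2 n_min. For claim 2, a Davis–Kahan argument
(`IsSecondEigenvector.exists_decomposition`) tests the eigenvector equation against the component of
v₂(L_A) off the community vector.

Random half (`le_measureReal_laplacian_close`). L_A − L_{𝔼A} is the diagonal matrix of degree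
deviations minus A − 𝔼A. With R = √(n p l), a Bernstein-type bound and a union over vertices keep
the degrees within 2 w_p R. For A − 𝔼A, Hoeffding on the pairs of points of a 1/2-net gives 6 w_p R.
Hoeffding suffices although its variance proxy ignores p: for fixed p, n p l eventually dominates
the log-cardinality of the pairs, because l → ∞. -/

/-! ### Courant–Fischer bounds -/

/-- A real symmetric matrix has an orthonormal eigenbasis listed by increasing eigenvalue. -/
theorem exists_ascending_eigenbasis {n : ℕ} {M : Matrix (Fin n) (Fin n) ℝ} (hM : M.IsHermitian) :
    ∃ b : Fin n → Fin n → ℝ,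
      (∀ x : Fin n → ℝ, x ⬝ᵥ x = ∑ k, (b k ⬝ᵥ x) ^ 2) ∧
      (∀ x : Fin n → ℝ, x ⬝ᵥ M *ᵥ x = ∑ k : Fin n, kthEigenvalue M (k + 1) * (b k ⬝ᵥ x) ^ 2) ∧
      Monotone fun k : Fin n => kthEigenvalue M (k + 1) := by
  have hk : ∀ k : Fin n, kthEigenvalue M (k + 1) =
      hM.eigenvalues₀ ⟨n - (k + 1), by rw [Fintype.card_fin]; omega⟩ := fun k => by
    rw [kthEigenvalue, dif_pos ⟨hM, by omega, by omega⟩]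
  -- The reversal turns Mathlib's decreasing order into an increasing one; `e` then passes to the
  -- index set of the eigenvectors. The shift `k + 1` appears because `kthEigenvalue` counts from 1.
  let r : Fin n ≃ Fin (Fintype.card (Fin n)) := Fin.revPerm.trans (finCongr (by simp))
  let e : Fin n ≃ Fin n := r.trans (Fintype.equivOfCardEq (Fintype.card_fin _))
  have hev : ∀ k : Fin n, hM.eigenvalues (e k) = kthEigenvalue M (k + 1) := fun k => by
    rw [hk, Matrix.IsHermitian.eigenvalues]
    congr 1
    simp [e]
    ext
    simp [r]
  let b := hM.eigenvectorBasis.reindex e.symm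
  have hinner : ∀ k (x : Fin n → ℝ), inner ℝ (b k) (WithLp.toLp 2 x) = (b k).ofLp ⬝ᵥ x := by
    intro k x
    rw [EuclideanSpace.inner_eq_star_dotProduct]
    simp [dotProduct_comm]
  have hpars : ∀ x y : Fin n → ℝ,
      x ⬝ᵥ y = ∑ k, ((b k).ofLp ⬝ᵥ x) * ((b k).ofLp ⬝ᵥ y) := by
    intro x y
    have h := b.sum_inner_mul_inner (WithLp.toLp 2 x) (WithLp.toLp 2 y)
    simp only [real_inner_comm (b _) (WithLp.toLp 2 x)] at h
    simp only [hinner] at h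
    rw [h, EuclideanSpace.inner_eq_star_dotProduct]
    simp [dotProduct_comm]
  have ht : Mᵀ = M := by
    simpa [Matrix.IsHermitian, Matrix.conjTranspose_eq_transpose_of_trivial] using hM
  refine ⟨fun k => (b k).ofLp, fun x => ?_, fun x => ?_, fun k l hkl => ?_⟩
  · simp only [hpars x x, sq]
  · rw [hpars]
    refine Finset.sum_congr rfl fun k _ => ?_
    have : (b k).ofLp ⬝ᵥ M *ᵥ x = kthEigenvalue M (k + 1) * ((b k).ofLp ⬝ᵥ x) := by
      rw [Matrix.dotProduct_mulVec, ← Matrix.mulVec_transpose, ht, ← hev]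
      have := hM.mulVec_eigenvectorBasis (e k)
      simp only [b, OrthonormalBasis.reindex_apply, Equiv.symm_symm]
      rw [this, smul_dotProduct, smul_eq_mul]
    rw [this]; ring
  · simp only [hk]
    apply hM.eigenvalues₀_antitone
    simp only [Fin.mk_le_mk]
    have : (k : ℕ) ≤ l := hkl
    omega

theorem dotProduct_self_nonneg_real {n : ℕ} (x : Fin n → ℝ) : 0 ≤ x ⬝ᵥ x :=
  Finset.sum_nonneg fun i _ => mul_self_nonneg (x i)

theorem dotProduct_self_pos_of_ne_zero {n : ℕ} {x : Fin n → ℝ} (hx : x ≠ 0) : 0 < x ⬝ᵥ x :=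
  lt_of_le_of_ne (dotProduct_self_nonneg_real x)
    fun h => hx (dotProduct_self_eq_zero.mp h.symm)

/-- If the quadratic form of `M` is at least `c` on the unit vectors orthogonal to `m` given
vectors, then `λ_{m+1}(M) ≥ c`. -/
theorem le_kthEigenvalue {n m : ℕ} (hm : m < n) {M : Matrix (Fin n) (Fin n) ℝ}
    (hM : M.IsHermitian) (f : Fin m → Fin n → ℝ) {c : ℝ}
    (h : ∀ x : Fin n → ℝ, (∀ i, f i ⬝ᵥ x = 0) → c * (x ⬝ᵥ x) ≤ x ⬝ᵥ M *ᵥ x) :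
    c ≤ kthEigenvalue M (m + 1) := by
  obtain ⟨b, hb1, hb2, hmono⟩ := exists_ascending_eigenbasis hM
  -- There are m + (n − 1 − m) < n linear conditions, so some nonzero x is orthogonal to every `f i`
  -- and to all eigenvectors beyond λ_{m+1}.
  let T : Matrix (Fin m ⊕ {k : Fin n // m < k}) (Fin n) ℝ :=
    Matrix.of (Sum.elim f fun k => b k.1)
  have hcard : Fintype.card {k : Fin n // m < k} = n - 1 - m := by
    rw [Fintype.card_subtype]
    have : (Finset.univ.filter fun k : Fin n => m < k) = Finset.Ioi ⟨m, hm⟩ := by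
      ext k; simp [Fin.lt_def]
    rw [this, Fin.card_Ioi]
  have hker : LinearMap.ker T.mulVecLin ≠ ⊥ := by
    apply LinearMap.ker_ne_bot_of_finrank_lt
    simp only [Module.finrank_fintype_fun_eq_card, Fintype.card_sum, Fintype.card_fin, hcard]
    omega
  obtain ⟨x, hxT, hx0⟩ := (Submodule.ne_bot_iff _).mp hker
  have hT : ∀ i, T i ⬝ᵥ x = 0 := fun i => congrFun (LinearMap.mem_ker.mp hxT) i
  have h1 := h x fun i => hT (Sum.inl i)
  have h2 : x ⬝ᵥ M *ᵥ x ≤ kthEigenvalue M (m + 1) * (x ⬝ᵥ x) := by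
    rw [hb2, hb1, Finset.mul_sum]
    refine Finset.sum_le_sum fun k _ => ?_
    rcases le_or_gt (k : ℕ) m with hk | hk
    · exact mul_le_mul_of_nonneg_right (hmono (show k ≤ ⟨m, hm⟩ from hk)) (sq_nonneg _)
    · have : b k ⬝ᵥ x = 0 := hT (Sum.inr ⟨k, hk⟩)
      simp [this]
  exact le_of_mul_le_mul_right (h1.trans h2) (dotProduct_self_pos_of_ne_zero hx0)

/-- If the quadratic form of `M` is at most `c` on the unit vectors of the span of `m + 1` linearly
independent vectors, then `λ_{m+1}(M) ≤ c`. -/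
theorem kthEigenvalue_le {n m : ℕ} (hm : m < n) {M : Matrix (Fin n) (Fin n) ℝ}
    (hM : M.IsHermitian) {f : Fin (m + 1) → Fin n → ℝ} (hf : LinearIndependent ℝ f) {c : ℝ}
    (h : ∀ a : Fin (m + 1) → ℝ,
      (∑ i, a i • f i) ⬝ᵥ M *ᵥ (∑ i, a i • f i) ≤ c * ((∑ i, a i • f i) ⬝ᵥ (∑ i, a i • f i))) :
    kthEigenvalue M (m + 1) ≤ c := by
  obtain ⟨b, hb1, hb2, hmono⟩ := exists_ascending_eigenbasis hM
  -- These are m conditions on m + 1 coefficients: some nontrivial combination of the `f i` is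
  -- orthogonal to the first m eigenvectors.
  let T : Matrix {k : Fin n // k < m} (Fin (m + 1)) ℝ :=
    Matrix.of fun k i => b k.1 ⬝ᵥ f i
  have hcard : Fintype.card {k : Fin n // k < m} = m := by
    rw [Fintype.card_subtype]
    have : (Finset.univ.filter fun k : Fin n => k < m) = Finset.Iio ⟨m, hm⟩ := by
      ext k; simp [Fin.lt_def]
    rw [this, Fin.card_Iio]
  have hker : LinearMap.ker T.mulVecLin ≠ ⊥ := by
    apply LinearMap.ker_ne_bot_of_finrank_lt
    simp only [Module.finrank_fintype_fun_eq_card, Fintype.card_fin, hcard]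
    omega
  obtain ⟨a, haT, ha0⟩ := (Submodule.ne_bot_iff _).mp hker
  set x := ∑ i, a i • f i with hx
  have hx0 : x ≠ 0 := fun h0 =>
    ha0 (funext fun i => Fintype.linearIndependent_iff.mp hf a h0 i)
  have hT : ∀ k : Fin n, k < m → b k ⬝ᵥ x = 0 := fun k hk => by
    have : T ⟨k, hk⟩ ⬝ᵥ a = 0 := congrFun (LinearMap.mem_ker.mp haT) _
    rw [hx, dotProduct_sum, ← this]
    simp only [dotProduct_smul, smul_eq_mul]
    exact Finset.sum_congr rfl fun i _ => mul_comm _ _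
  have h2 : kthEigenvalue M (m + 1) * (x ⬝ᵥ x) ≤ x ⬝ᵥ M *ᵥ x := by
    rw [hb2, hb1, Finset.mul_sum]
    refine Finset.sum_le_sum fun k _ => ?_
    rcases le_or_gt m k with hk | hk
    · exact mul_le_mul_of_nonneg_right (hmono (show ⟨m, hm⟩ ≤ k from hk)) (sq_nonneg _)
    · simp [hT k hk]
  exact le_of_mul_le_mul_right (h2.trans (h a)) (dotProduct_self_pos_of_ne_zero hx0)

/-! ### Spectrum of the two-block Laplacian -/

/-- The vector that is constant on each community and orthogonal to the all-ones vector. -/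
def communityVector {n : ℕ} (Ia Ib : Finset (Fin n)) : Fin n → ℝ :=
  fun i => if i ∈ Ia then (Ib.card : ℝ) else -Ia.card

section TwoBlock

variable {n : ℕ} {Ia Ib : Finset (Fin n)}

theorem sum_add_sum_of_isCompl (h : IsCompl Ia Ib) (x : Fin n → ℝ) :
    ∑ i ∈ Ia, x i + ∑ i ∈ Ib, x i = ∑ i, x i := by
  rw [← h.compl_eq, Finset.sum_add_sum_compl]

theorem card_add_card_of_isCompl (h : IsCompl Ia Ib) : (Ia.card : ℝ) + Ib.card = n := by
  simpa using sum_add_sum_of_isCompl h 1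

theorem twoBlock_mulVec (h : IsCompl Ia Ib) (a b : ℝ) (x : Fin n → ℝ) (i : Fin n) :
    (twoBlock Ia a b *ᵥ x) i =
      if i ∈ Ia then a * ∑ j ∈ Ia, x j + b * ∑ j ∈ Ib, x j
      else b * ∑ j ∈ Ia, x j + a * ∑ j ∈ Ib, x j := by
  have hb : ∀ j ∈ Ib, j ∉ Ia := fun j hj => by
    rw [← h.compl_eq] at hj; simpa using hj
  rw [Matrix.mulVec, dotProduct, ← sum_add_sum_of_isCompl h]
  split_ifs with hi <;> simp only [Finset.mul_sum] <;> congr 1 <;>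
    refine Finset.sum_congr rfl fun j hj => ?_ <;> simp [twoBlock, hi, hj, hb]

theorem communityVector_dotProduct (h : IsCompl Ia Ib) (x : Fin n → ℝ) :
    communityVector Ia Ib ⬝ᵥ x = Ib.card * ∑ i ∈ Ia, x i - Ia.card * ∑ i ∈ Ib, x i := by
  have hb : ∀ j ∈ Ib, j ∉ Ia := fun j hj => by
    rw [← h.compl_eq] at hj; simpa using hj
  rw [dotProduct, ← sum_add_sum_of_isCompl h, Finset.mul_sum, Finset.mul_sum, sub_eq_add_neg,
    ← Finset.sum_neg_distrib]
  congr 1 <;> refine Finset.sum_congr rfl fun j hj => ?_ <;> simp [communityVector, hj, hb]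

theorem communityVector_dotProduct_one (h : IsCompl Ia Ib) :
    communityVector Ia Ib ⬝ᵥ 1 = 0 := by
  rw [communityVector_dotProduct h]; simp; ring

theorem laplacian_twoBlock_mulVec (h : IsCompl Ia Ib) (a b : ℝ) (x : Fin n → ℝ) (i : Fin n) :
    (laplacian (twoBlock Ia a b) *ᵥ x) i =
      if i ∈ Ia then
        (a * Ia.card + b * Ib.card) * x i - (a * ∑ j ∈ Ia, x j + b * ∑ j ∈ Ib, x j)
      else (b * Ia.card + a * Ib.card) * x i - (b * ∑ j ∈ Ia, x j + a * ∑ j ∈ Ib, x j) := by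
  rw [laplacian, Matrix.sub_mulVec, Pi.sub_apply, Matrix.mulVec_diagonal, twoBlock_mulVec h,
    twoBlock_mulVec h]
  split_ifs <;> simp

theorem laplacian_twoBlock_mulVec_communityVector (h : IsCompl Ia Ib) (a b : ℝ) :
    laplacian (twoBlock Ia a b) *ᵥ communityVector Ia Ib =
      ((n : ℝ) * b) • communityVector Ia Ib := by
  have hb : ∀ j ∈ Ib, j ∉ Ia := fun j hj => by
    rw [← h.compl_eq] at hj; simpa using hj
  have h1 : ∑ j ∈ Ia, communityVector Ia Ib j = Ia.card * Ib.card := by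
    rw [Finset.sum_congr rfl (g := fun _ => (Ib.card : ℝ)) fun j hj => by
      simp [communityVector, hj]]
    simp
  have h2 : ∑ j ∈ Ib, communityVector Ia Ib j = -(Ia.card * Ib.card) := by
    rw [Finset.sum_congr rfl (g := fun _ => -(Ia.card : ℝ)) fun j hj => by
      simp [communityVector, hb j hj]]
    simp [mul_comm]
  ext i
  rw [laplacian_twoBlock_mulVec h, h1, h2, ← card_add_card_of_isCompl h]
  by_cases hi : i ∈ Ia <;> simp [communityVector, hi] <;> ring

theorem isHermitian_laplacian_twoBlock (a b : ℝ) : (laplacian (twoBlock Ia a b)).IsHermitian :=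
  laplacian_isHermitian fun i j => by simp [twoBlock, iff_comm]

/-- The two orthogonality conditions make the sum of x over each community vanish, so the Laplacian
acts on x through the degrees alone. These are nb + (a − b)|Ia| and nb + (a − b)|Ib|. -/
theorem le_dotProduct_laplacian_twoBlock (h : IsCompl Ia Ib) (hn : 0 < n) {a b : ℝ}
    (hab : b ≤ a) {x : Fin n → ℝ} (h1 : x ⬝ᵥ 1 = 0) (h2 : communityVector Ia Ib ⬝ᵥ x = 0) :
    (n * b + (a - b) * ((min Ia.card Ib.card : ℕ) : ℝ)) * (x ⬝ᵥ x) ≤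
      x ⬝ᵥ laplacian (twoBlock Ia a b) *ᵥ x := by
  have hc := card_add_card_of_isCompl h
  have hs : ∑ i ∈ Ia, x i + ∑ i ∈ Ib, x i = 0 := by
    rw [sum_add_sum_of_isCompl h]; simpa [dotProduct] using h1
  have hSa : ∑ i ∈ Ia, x i = 0 := by
    rw [communityVector_dotProduct h] at h2
    have h3 : (n : ℝ) * ∑ i ∈ Ia, x i = 0 := by
      rw [← hc]; linear_combination h2 + (Ia.card : ℝ) * hs
    exact (mul_eq_zero.mp h3).resolve_left (by positivity)
  have hSb : ∑ i ∈ Ib, x i = 0 := by linarith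
  have hma : ((min Ia.card Ib.card : ℕ) : ℝ) ≤ Ia.card := by exact_mod_cast min_le_left _ _
  have hmb : ((min Ia.card Ib.card : ℕ) : ℝ) ≤ Ib.card := by exact_mod_cast min_le_right _ _
  rw [dotProduct, dotProduct, Finset.mul_sum]
  refine Finset.sum_le_sum fun i _ => ?_
  rw [laplacian_twoBlock_mulVec h, hSa, hSb, ← hc]
  have hx := mul_self_nonneg (x i)
  have hd : 0 ≤ a - b := by linarith
  split_ifs
  · have := mul_le_mul_of_nonneg_right (mul_le_mul_of_nonneg_left hma hd) hx
    nlinarith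
  · have := mul_le_mul_of_nonneg_right (mul_le_mul_of_nonneg_left hmb hd) hx
    nlinarith

theorem communityVector_dotProduct_self_pos (hn : 0 < n) (hm : 0 < min Ia.card Ib.card) :
    0 < communityVector Ia Ib ⬝ᵥ communityVector Ia Ib := by
  apply dotProduct_self_pos_of_ne_zero
  intro h0
  have := congrFun h0 ⟨0, hn⟩
  have h1 := lt_of_lt_of_le hm (min_le_left _ _)
  have h2 := lt_of_lt_of_le hm (min_le_right _ _)
  simp only [communityVector, Pi.zero_apply] at this
  split_ifs at this
  · norm_cast at this; omega
  · rw [neg_eq_zero] at this; norm_cast at this; omega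

/-! ### Perturbation of eigenvalues and of the second eigenvector -/

section Perturbation

variable {a b ε : ℝ} {M : Matrix (Fin n) (Fin n) ℝ}

/-- Weyl's inequality in the form needed here; `hε` is the operator norm bound ‖M − L‖ ≤ ε stated
for the bilinear form. -/
theorem le_kthEigenvalue_three_of_close (h : IsCompl Ia Ib) (hn : 2 < n) (hab : b ≤ a)
    (hM : M.IsHermitian)
    (hε : ∀ x y : Fin n → ℝ, |y ⬝ᵥ (M - laplacian (twoBlock Ia a b)) *ᵥ x| ≤
      ε * (√(x ⬝ᵥ x) * √(y ⬝ᵥ y))) :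
    n * b + (a - b) * ((min Ia.card Ib.card : ℕ) : ℝ) - ε ≤ kthEigenvalue M 3 := by
  refine le_kthEigenvalue (m := 2) hn hM ![1, communityVector Ia Ib] fun x hx => ?_
  have h1 : x ⬝ᵥ 1 = 0 := by rw [dotProduct_comm]; exact hx 0
  have h2 := le_dotProduct_laplacian_twoBlock h (by omega) hab h1 (hx 1)
  have h3 := hε x x
  rw [Real.mul_self_sqrt (dotProduct_self_nonneg_real x), Matrix.sub_mulVec,
    dotProduct_sub] at h3
  have := (abs_le.mp h3).1
  linarith

theorem kthEigenvalue_two_le_of_close (h : IsCompl Ia Ib) (hn : 1 < n)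
    (hm : 0 < min Ia.card Ib.card) (hb : 0 ≤ b) (hM : M.IsHermitian)
    (hε : ∀ x y : Fin n → ℝ, |y ⬝ᵥ (M - laplacian (twoBlock Ia a b)) *ᵥ x| ≤
      ε * (√(x ⬝ᵥ x) * √(y ⬝ᵥ y))) :
    kthEigenvalue M 2 ≤ n * b + ε := by
  have hv := communityVector_dotProduct_self_pos (by omega) hm
  have hv1 := communityVector_dotProduct_one h
  set v := communityVector Ia Ib with hvdef
  have h1v : 1 ⬝ᵥ v = 0 := by rw [dotProduct_comm, hv1]
  have h11 : (1 : Fin n → ℝ) ⬝ᵥ 1 = n := by simp [dotProduct]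
  refine kthEigenvalue_le (m := 1) hn hM (f := ![1, v]) ?_ fun s => ?_
  · rw [LinearIndependent.pair_iff]
    intro s t hst
    have e1 := congrArg (fun x => 1 ⬝ᵥ x) hst
    have e2 := congrArg (fun x => v ⬝ᵥ x) hst
    simp only [dotProduct_add, dotProduct_smul, h1v, hv1, h11, dotProduct_zero, smul_eq_mul,
      mul_zero, add_zero, zero_add] at e1 e2
    exact ⟨(mul_eq_zero.mp e1).resolve_right (by positivity),
      (mul_eq_zero.mp e2).resolve_right hv.ne'⟩
  · simp only [Fin.sum_univ_two, Nat.reduceAdd, Fin.isValue, Matrix.cons_val_zero,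
      Matrix.cons_val_one]
    set x := s 0 • (1 : Fin n → ℝ) + s 1 • v with hx
    have hxx : x ⬝ᵥ x = s 0 ^ 2 * n + s 1 ^ 2 * (v ⬝ᵥ v) := by
      simp only [hx, dotProduct_add, add_dotProduct, dotProduct_smul, smul_dotProduct, h1v, hv1,
        h11, smul_eq_mul]
      ring
    have hxL : x ⬝ᵥ laplacian (twoBlock Ia a b) *ᵥ x = s 1 ^ 2 * (v ⬝ᵥ v) * (n * b) := by
      have : laplacian (twoBlock Ia a b) *ᵥ x = (s 1 * (n * b)) • v := by
        rw [hx, Matrix.mulVec_add, Matrix.mulVec_smul, Matrix.mulVec_smul, laplacian_mulVec_one,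
          hvdef, laplacian_twoBlock_mulVec_communityVector h, smul_zero, zero_add, smul_smul]
      rw [this]
      simp only [hx, add_dotProduct, dotProduct_smul, smul_dotProduct, h1v, smul_eq_mul]
      ring
    have h3 := hε x x
    rw [Real.mul_self_sqrt (dotProduct_self_nonneg_real x), Matrix.sub_mulVec,
      dotProduct_sub] at h3
    have h4 := (abs_le.mp h3).2
    -- The direction 𝟙 contributes 0 to the form, which is at most nb times its squared norm since b
    -- ≥ 0.
    have h5 : 0 ≤ s 0 ^ 2 * n * (n * b) := by positivity
    have h6 : n * b * (x ⬝ᵥ x) = s 0 ^ 2 * n * (n * b) + s 1 ^ 2 * (v ⬝ᵥ v) * (n * b) := by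
      rw [hxx]; ring
    rw [hxL] at h4
    rw [add_mul]
    linarith

/-- Decomposition of a second eigenvector of a perturbation of the Laplacian of the two-block
matrix along the community vector. -/
theorem IsSecondEigenvector.exists_decomposition (h : IsCompl Ia Ib) (hn : 1 < n)
    (hm : 0 < min Ia.card Ib.card) (hb : 0 ≤ b) (hab : b ≤ a) (hM : M.IsHermitian)
    (hε : ∀ x y : Fin n → ℝ, |y ⬝ᵥ (M - laplacian (twoBlock Ia a b)) *ᵥ x| ≤
      ε * (√(x ⬝ᵥ x) * √(y ⬝ᵥ y))) {u : Fin n → ℝ} (hu : IsSecondEigenvector M u) :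
    ∃ (r : ℝ) (w : Fin n → ℝ), u = r • communityVector Ia Ib + w ∧
      communityVector Ia Ib ⬝ᵥ w = 0 ∧
      √(w ⬝ᵥ w) * ((a - b) * ((min Ia.card Ib.card : ℕ) : ℝ) - ε) ≤ ε := by
  have hv := communityVector_dotProduct_self_pos (by omega) hm
  have hv1 := communityVector_dotProduct_one h
  have hLv := laplacian_twoBlock_mulVec_communityVector h a b
  have hlam := kthEigenvalue_two_le_of_close h hn hm hb hM hε
  have hgapL := @le_dotProduct_laplacian_twoBlock n Ia Ib h (by omega) a b hab
  set v := communityVector Ia Ib with hvdef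
  set r := (v ⬝ᵥ u) / (v ⬝ᵥ v) with hr
  obtain ⟨w, hw⟩ : ∃ w, w = u - r • v := ⟨_, rfl⟩
  have huw : u = r • v + w := by rw [hw]; abel
  have hvw : v ⬝ᵥ w = 0 := by
    rw [hw, dotProduct_sub, dotProduct_smul, smul_eq_mul, hr, div_mul_cancel₀ _ hv.ne', sub_self]
  have hwv : w ⬝ᵥ v = 0 := by rw [dotProduct_comm, hvw]
  -- Orthogonality of u to 𝟙 is essential: when b = 0 the eigenvalue nb of the community vector
  -- coincides with that of 𝟙.
  have hw1 : w ⬝ᵥ 1 = 0 := by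
    rw [hw, sub_dotProduct, smul_dotProduct, hv1, hu.orthogonal, smul_zero, sub_zero]
  refine ⟨r, w, huw, hvw, ?_⟩
  have hww : 0 ≤ w ⬝ᵥ w := dotProduct_self_nonneg_real w
  have hwu : w ⬝ᵥ u = w ⬝ᵥ w := by
    rw [huw, dotProduct_add, dotProduct_smul, hwv, smul_zero, zero_add]
  have hLu : w ⬝ᵥ laplacian (twoBlock Ia a b) *ᵥ u =
      w ⬝ᵥ laplacian (twoBlock Ia a b) *ᵥ w := by
    rw [huw, Matrix.mulVec_add, Matrix.mulVec_smul, hLv, dotProduct_add, dotProduct_smul,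
      dotProduct_smul, hwv, smul_zero, smul_zero, zero_add]
  -- The tested quantity is w·(M − L)u = λ₂(M)|w|² − w·Lw. Comparing it with w·Lw ≥ (nb + g)|w|² and
  -- λ₂(M) ≤ nb + ε gives (g − ε)|w|² ≤ ε|w|.
  have h1 := (abs_le.mp (hε u w)).1
  rw [Matrix.sub_mulVec, dotProduct_sub, hu.eigen, dotProduct_smul, hwu, smul_eq_mul, hu.unit,
    Real.sqrt_one, one_mul, hLu] at h1
  have h2 := hgapL hw1 hvw
  have h3 := mul_le_mul_of_nonneg_right hlam hww
  have hs := Real.mul_self_sqrt hww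
  have hs0 := Real.sqrt_nonneg (w ⬝ᵥ w)
  rcases hs0.eq_or_lt with h0 | hpos
  · rw [← h0, zero_mul]
    have := (abs_nonneg _).trans (hε u u)
    rw [hu.unit] at this
    simpa using this
  · refine le_of_mul_le_mul_right ?_ hpos
    rw [mul_right_comm, hs]
    linarith

theorem sinAngle_le_of_close (h : IsCompl Ia Ib) (hn : 1 < n)
    (hm : 0 < min Ia.card Ib.card) (hb : 0 ≤ b) (hab : b < a) (hM : M.IsHermitian)
    (hε : ∀ x y : Fin n → ℝ, |y ⬝ᵥ (M - laplacian (twoBlock Ia a b)) *ᵥ x| ≤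
      ε * (√(x ⬝ᵥ x) * √(y ⬝ᵥ y))) {u v : Fin n → ℝ} (hu : IsSecondEigenvector M u)
    (hv : IsSecondEigenvector (laplacian (twoBlock Ia a b)) v) :
    sinAngle u v ≤ 2 * ε / ((a - b) * ((min Ia.card Ib.card : ℕ) : ℝ)) := by
  have hgap : 0 < (a - b) * ((min Ia.card Ib.card : ℕ) : ℝ) :=
    mul_pos (by linarith) (by exact_mod_cast hm)
  obtain ⟨r, w, huw, hcw, hw⟩ := hu.exists_decomposition h hn hm hb hab.le hM hε
  -- With M = L and ε = 0 the decomposition forces z = 0: v is a multiple of the community vector.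
  obtain ⟨s, z, hvz, -, hz⟩ := hv.exists_decomposition h hn hm hb hab.le
    (isHermitian_laplacian_twoBlock a b) (ε := 0) (by simp)
  set g := (a - b) * ((min Ia.card Ib.card : ℕ) : ℝ)
  set c := communityVector Ia Ib
  have hwc : w ⬝ᵥ c = 0 := by rw [dotProduct_comm, hcw]
  have hzz : 0 ≤ z ⬝ᵥ z := dotProduct_self_nonneg_real z
  have hz0 : z = 0 := by
    rw [sub_zero] at hz
    have h0 : √(z ⬝ᵥ z) ≤ 0 := le_of_mul_le_mul_right (by simpa using hz) hgap
    rw [Real.sqrt_le_iff] at h0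
    exact dotProduct_self_eq_zero.mp (le_antisymm (by simpa using h0.2) hzz)
  rw [hz0, add_zero] at hvz
  have hvv : s ^ 2 * (c ⬝ᵥ c) = 1 := by
    have := hv.unit
    rw [hvz, dotProduct_smul, smul_dotProduct, smul_eq_mul, smul_eq_mul] at this
    linarith
  have huu : r ^ 2 * (c ⬝ᵥ c) + w ⬝ᵥ w = 1 := by
    have := hu.unit
    rw [huw] at this
    simp only [add_dotProduct, dotProduct_add, dotProduct_smul, smul_dotProduct, hwc, hcw,
      smul_eq_mul] at this
    linarith
  have huv : u ⬝ᵥ v = r * s * (c ⬝ᵥ c) := by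
    rw [huw, hvz]
    simp only [add_dotProduct, dotProduct_smul, smul_dotProduct, hwc, smul_eq_mul]
    ring
  have hsin : sinAngle u v = √(w ⬝ᵥ w) := by
    rw [sinAngle, sq_abs, huv]
    congr 1
    linear_combination -(r ^ 2 * (c ⬝ᵥ c)) * hvv - huu
  have hle1 : sinAngle u v ≤ 1 := by
    rw [sinAngle, Real.sqrt_le_one]
    linarith [sq_nonneg |u ⬝ᵥ v|]
  rw [le_div_iff₀ hgap]
  have h0 : 0 ≤ sinAngle u v := Real.sqrt_nonneg _
  rw [← hsin] at hw
  -- If 2ε ≥ g the bound is at least 1 and holds trivially; otherwise g − ε > g/2.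
  rcases le_or_gt g (2 * ε) with hg | hg
  · nlinarith
  · nlinarith

end Perturbation

end TwoBlock

/-! ### Nets and operator norms -/

section Net

/-- The unit ball of a `d`-dimensional normed space has a `1/2`-net with at most `5 ^ d` points. -/
theorem exists_half_net (E : Type*) [NormedAddCommGroup E] [NormedSpace ℝ E]
    [FiniteDimensional ℝ E] :
    ∃ s : Finset E, s.card ≤ 5 ^ Module.finrank ℝ E ∧ (∀ y ∈ s, ‖y‖ ≤ 1) ∧
      ∀ x : E, ‖x‖ ≤ 1 → ∃ y ∈ s, ‖x - y‖ ≤ 1 / 2 := by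
  classical
  have hcard : ∀ s : Finset E, (∀ y ∈ s, ‖y‖ ≤ 1) →
      (∀ y ∈ s, ∀ z ∈ s, y ≠ z → 1 / 2 ≤ ‖y - z‖) → s.card ≤ 5 ^ Module.finrank ℝ E := by
    intro s h1 h2
    -- Doubling matches the Besicovitch packing bound, which concerns 1-separated points in the ball
    -- of radius 2.
    have hinj : Function.Injective fun y : E => (2 : ℝ) • y :=
      smul_right_injective E (two_ne_zero)
    rw [← Finset.card_image_of_injective s hinj]
    apply Besicovitch.card_le_of_separated
    · simp only [Finset.mem_image, forall_exists_index, and_imp, forall_apply_eq_imp_iff₂]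
      intro y hy
      rw [norm_smul, Real.norm_two]
      linarith [h1 y hy]
    · simp only [Finset.mem_image, forall_exists_index, and_imp, forall_apply_eq_imp_iff₂]
      intro y hy z hz hyz
      rw [← smul_sub, norm_smul, Real.norm_two]
      linarith [h2 y hy z hz fun h => hyz (by rw [h])]
  -- Without a net of this size, every 1/2-separated set in the ball could be enlarged, eventually
  -- beyond the packing bound.
  by_contra! hcon
  have key : ∀ k : ℕ, ∃ s : Finset E, s.card = k ∧ (∀ y ∈ s, ‖y‖ ≤ 1) ∧
      ∀ y ∈ s, ∀ z ∈ s, y ≠ z → 1 / 2 ≤ ‖y - z‖ := by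
    intro k
    induction k with
    | zero => exact ⟨∅, by simp⟩
    | succ k ih =>
      obtain ⟨s, hk, h1, h2⟩ := ih
      obtain ⟨x, hx, hxs⟩ := hcon s (hcard s h1 h2) h1
      have hx' : x ∉ s := fun h => by
        have := hxs x h
        norm_num at this
      refine ⟨insert x s, by rw [Finset.card_insert_of_notMem hx', hk], ?_, ?_⟩
      · simpa [hx] using h1
      · intro y hy z hz hyz
        rcases Finset.mem_insert.mp hy with hyx | hys <;>
          rcases Finset.mem_insert.mp hz with hzx | hzs
        · exact absurd (hyx.trans hzx.symm) hyz
        · rw [hyx]; exact (hxs z hzs).le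
        · rw [hzx, norm_sub_rev]; exact (hxs y hys).le
        · exact h2 y hys z hzs hyz
  obtain ⟨s, hs, h1, h2⟩ := key (5 ^ Module.finrank ℝ E + 1)
  have := hcard s h1 h2
  omega

variable {E : Type*} [NormedAddCommGroup E] [InnerProductSpace ℝ E] {s : Set E}

/-- Replacing z/‖z‖ by a net point loses at most half of ‖z‖. One-sided bounds suffice. -/
theorem norm_le_of_half_net (hs : ∀ x : E, ‖x‖ ≤ 1 → ∃ y ∈ s, ‖x - y‖ ≤ 1 / 2) {t : ℝ} {z : E}
    (hz : ∀ y ∈ s, inner ℝ y z ≤ t) : ‖z‖ ≤ 2 * t := by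
  rcases eq_or_ne z 0 with rfl | h0
  · obtain ⟨y, hy, -⟩ := hs 0 (by simp)
    have := hz y hy
    simp only [inner_zero_right] at this
    simpa using this
  · have hpos := norm_pos_iff.mpr h0
    obtain ⟨y, hy, hyz⟩ := hs (‖z‖⁻¹ • z) (by rw [norm_smul]; simp [hpos.ne'])
    have h1 : inner ℝ (‖z‖⁻¹ • z) z = ‖z‖ := by
      rw [real_inner_smul_left, real_inner_self_eq_norm_sq]
      field_simp
    have h2 : inner ℝ (‖z‖⁻¹ • z - y) z ≤ 1 / 2 * ‖z‖ :=
      (real_inner_le_norm _ _).trans (mul_le_mul_of_nonneg_right hyz hpos.le)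
    rw [inner_sub_left, h1] at h2
    linarith [hz y hy]

/-- The factor 2 is paid twice, for the output vector and for the input vector. -/
theorem opNorm_le_of_half_net (hs : ∀ x : E, ‖x‖ ≤ 1 → ∃ y ∈ s, ‖x - y‖ ≤ 1 / 2) {t : ℝ}
    (T : E →L[ℝ] E) (hT : ∀ x ∈ s, ∀ y ∈ s, inner ℝ y (T x) ≤ t) : ‖T‖ ≤ 4 * t := by
  have h1 : ∀ x ∈ s, ‖T x‖ ≤ 2 * t := fun x hx => norm_le_of_half_net hs (hT x hx)
  have ht : 0 ≤ 2 * t := by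
    obtain ⟨y, hy, -⟩ := hs 0 (by simp)
    exact (norm_nonneg _).trans (h1 y hy)
  have h2 : ‖T‖ ≤ 2 * t + 1 / 2 * ‖T‖ := by
    refine ContinuousLinearMap.opNorm_le_of_unit_norm (by positivity) fun x hx => ?_
    obtain ⟨y, hy, hxy⟩ := hs x hx.le
    have h3 : T x = T y + T (x - y) := by rw [map_sub]; abel
    rw [h3]
    refine (norm_add_le _ _).trans (add_le_add (h1 y hy) ((T.le_opNorm _).trans ?_))
    rw [mul_comm]
    exact mul_le_mul_of_nonneg_right hxy (norm_nonneg _)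
  linarith

end Net

open scoped Matrix.Norms.L2Operator in
/-- A perturbation of a weighted graph moves the bilinear form of the Laplacian by at most the
maximal degree change plus the operator norm of the perturbation. -/
theorem abs_dotProduct_laplacian_sub_le {n : ℕ} (A B : Matrix (Fin n) (Fin n) ℝ) {d t : ℝ}
    (hd0 : 0 ≤ d) (hd : ∀ i, |((A - B) *ᵥ 1) i| ≤ d)
    (ht : ‖Matrix.toEuclideanCLM (𝕜 := ℝ) (A - B)‖ ≤ t) (x y : Fin n → ℝ) :
    |y ⬝ᵥ (laplacian A - laplacian B) *ᵥ x| ≤ (d + t) * (√(x ⬝ᵥ x) * √(y ⬝ᵥ y)) := by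
  have hL : laplacian A - laplacian B = Matrix.diagonal ((A - B) *ᵥ 1) - (A - B) := by
    rw [laplacian, laplacian, Matrix.sub_mulVec, sub_sub_sub_comm, Matrix.diagonal_sub]
    rfl
  have hD : ‖Matrix.toEuclideanCLM (𝕜 := ℝ) (Matrix.diagonal ((A - B) *ᵥ 1))‖ ≤ d := by
    rw [Matrix.l2_opNorm_toEuclideanCLM, Matrix.l2_opNorm_diagonal, pi_norm_le_iff_of_nonneg hd0]
    exact hd
  have hnorm : ∀ z : Fin n → ℝ, ‖WithLp.toLp 2 z‖ = √(z ⬝ᵥ z) := fun z => by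
    rw [EuclideanSpace.norm_eq, dotProduct]
    simp [sq]
  have hop : ‖Matrix.toEuclideanCLM (𝕜 := ℝ) (laplacian A - laplacian B)‖ ≤ d + t := by
    rw [hL, map_sub]
    exact (norm_sub_le _ _).trans (add_le_add hD ht)
  have h1 := Matrix.inner_toEuclideanCLM (laplacian A - laplacian B) (WithLp.toLp 2 y)
    (WithLp.toLp 2 x)
  simp only at h1
  rw [← h1, ← hnorm, ← hnorm]
  refine (abs_real_inner_le_norm _ _).trans ?_
  rw [← mul_assoc, mul_comm]
  refine mul_le_mul_of_nonneg_right ?_ (norm_nonneg _)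
  exact (ContinuousLinearMap.le_opNorm _ _).trans (mul_le_mul_of_nonneg_right hop (norm_nonneg _))

/-! ### Moment generating functions and Chernoff's method -/

section TwoPoint

variable {Ω : Type*} [MeasurableSpace Ω] {μ : Measure Ω} {X : Ω → ℝ} {π w : ℝ}

theorem integral_comp_of_two_point_law (hX : Measurable X) (hπ0 : 0 ≤ π) (hπ1 : π ≤ 1)
    (hlaw : μ.map X = ENNReal.ofReal π • Measure.dirac w + ENNReal.ofReal (1 - π) • Measure.dirac 0)
    {f : ℝ → ℝ} (hf : Measurable f) :
    ∫ ω, f (X ω) ∂μ = π * f w + (1 - π) * f 0 := by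
  have hint : ∀ a : ℝ, Integrable f (Measure.dirac a) := fun a =>
    integrable_dirac (by simp [enorm_lt_top])
  rw [← integral_map hX.aemeasurable hf.aestronglyMeasurable, hlaw,
    integral_add_measure ((hint w).smul_measure ENNReal.ofReal_ne_top)
      ((hint 0).smul_measure ENNReal.ofReal_ne_top), integral_smul_measure, integral_smul_measure,
    integral_dirac, integral_dirac, ENNReal.toReal_ofReal hπ0,
    ENNReal.toReal_ofReal (by linarith), smul_eq_mul, smul_eq_mul]

theorem ae_mem_Icc_of_two_point_law (hX : Measurable X) (hw : 0 ≤ w)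
    (hlaw : μ.map X = ENNReal.ofReal π • Measure.dirac w +
      ENNReal.ofReal (1 - π) • Measure.dirac 0) :
    ∀ᵐ ω ∂μ, X ω ∈ Set.Icc 0 w := by
  refine ae_of_ae_map (p := fun x => x ∈ Set.Icc 0 w) hX.aemeasurable ?_
  rw [hlaw, ae_iff]
  simp [hw]

/-- Since 1 + x ≤ eˣ, the function is at most exp(π(e^{rw} − 1 − rw)), and eˣ − 1 − x ≤ x² for |x| ≤
1. Keeping the factor π is what puts p under the square root in the degree bound. -/
theorem mgf_sub_mean_le_of_two_point_law (hX : Measurable X) (hπ0 : 0 ≤ π) (hπ1 : π ≤ 1)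
    (hlaw : μ.map X = ENNReal.ofReal π • Measure.dirac w + ENNReal.ofReal (1 - π) • Measure.dirac 0)
    {r : ℝ} (hr : |r * w| ≤ 1) :
    mgf (fun ω => X ω - π * w) μ r ≤ Real.exp (π * (r * w) ^ 2) := by
  rw [mgf, integral_comp_of_two_point_law (f := fun x => Real.exp (r * (x - π * w))) hX hπ0 hπ1 hlaw
    (by fun_prop)]
  have h1 := (abs_le.mp (Real.abs_exp_sub_one_sub_id_le hr)).2
  have h2 : π * Real.exp (r * (w - π * w)) + (1 - π) * Real.exp (r * (0 - π * w)) =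
      (π * (Real.exp (r * w) - 1) + 1) * Real.exp (-(π * (r * w))) := by
    rw [show r * (w - π * w) = r * w + -(π * (r * w)) by ring,
      show r * (0 - π * w) = -(π * (r * w)) by ring, Real.exp_add]
    ring
  rw [h2]
  calc _ ≤ Real.exp (π * (Real.exp (r * w) - 1)) * Real.exp (-(π * (r * w))) :=
        mul_le_mul_of_nonneg_right (Real.add_one_le_exp _) (Real.exp_pos _).le
    _ ≤ _ := by
        rw [← Real.exp_add]
        exact Real.exp_le_exp.mpr (by nlinarith)

end TwoPoint

theorem measureReal_sum_ge_le_exp {Ω ι : Type*} [MeasurableSpace Ω] [Fintype ι] {μ : Measure Ω}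
    {Z : ι → Ω → ℝ} (hind : iIndepFun Z μ) (hmeas : ∀ i, Measurable (Z i))
    {s : ℝ} (hs : 0 ≤ s) (hint : ∀ i, Integrable (fun ω => Real.exp (s * Z i ω)) μ)
    {v : ι → ℝ} (hv : ∀ i, mgf (Z i) μ s ≤ Real.exp (v i)) (t : ℝ) :
    μ.real {ω | t ≤ ∑ i, Z i ω} ≤ Real.exp (-s * t + ∑ i, v i) := by
  have := hind.isProbabilityMeasure
  have h1 := measure_ge_le_exp_mul_mgf (X := ∑ i, Z i) (μ := μ) t hs
    (hind.integrable_exp_mul_sum hmeas fun i _ => hint i)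
  rw [hind.mgf_sum hmeas, Finset.sum_fn] at h1
  refine h1.trans ?_
  rw [Real.exp_add, Real.exp_sum]
  exact mul_le_mul_of_nonneg_left (Finset.prod_le_prod (fun _ _ => mgf_nonneg) fun i _ => hv i)
    (Real.exp_pos _).le

/-! ### Sums over unordered pairs -/

/-- The total weight that the matrix `C` gives to the unordered pair `e`. -/
def symmCoeff {n : ℕ} (C : Fin n → Fin n → ℝ) (e : {e : Fin n × Fin n // e.1 ≤ e.2}) : ℝ :=
  if e.1.1 = e.1.2 then C e.1.1 e.1.1 else C e.1.1 e.1.2 + C e.1.2 e.1.1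

theorem sum_symmCoeff {n : ℕ} (C : Fin n → Fin n → ℝ) :
    ∑ e, symmCoeff C e = ∑ i, ∑ j, C i j := by
  let G : Fin n × Fin n → ℝ := fun e =>
    if e.1 = e.2 then C e.1 e.1 else C e.1 e.2 + C e.2 e.1
  have h1 : ∑ e, symmCoeff C e = ∑ e ∈ Finset.univ.filter (fun e : Fin n × Fin n => e.1 ≤ e.2),
      G e := (Finset.sum_subtype _ (by simp) G).symm
  have h2 : ∀ i j : Fin n, (if i ≤ j then G (i, j) else 0) =
      (if i ≤ j then C i j else 0) + if i < j then C j i else 0 := by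
    intro i j
    rcases lt_trichotomy i j with h | h | h
    · simp [G, h.le, h, h.ne]
    · simp [G, h]
    · simp [h.not_ge, h.not_gt]
  rw [h1, Finset.sum_filter, Fintype.sum_prod_type]
  simp only [h2, Finset.sum_add_distrib]
  rw [Finset.sum_comm (f := fun i j => if i < j then C j i else 0), ← Finset.sum_add_distrib]
  refine Finset.sum_congr rfl fun i _ => ?_
  rw [← Finset.sum_add_distrib]
  refine Finset.sum_congr rfl fun j _ => ?_
  rcases le_or_gt i j with h | h
  · simp [h, h.not_gt]
  · simp [h, h.not_ge]

/-- Only the entries with i ≤ j are independent, so a linear statistic of a symmetric matrix must be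
regrouped in this way before Chernoff's method applies. -/
theorem sum_symmCoeff_mul {n : ℕ} (C X : Fin n → Fin n → ℝ) (hX : ∀ i j, X j i = X i j) :
    ∑ e, symmCoeff C e * X e.1.1 e.1.2 = ∑ i, ∑ j, C i j * X i j := by
  rw [← sum_symmCoeff]
  refine Finset.sum_congr rfl fun e _ => ?_
  unfold symmCoeff
  split_ifs with h
  · rw [← h]
  · simp only [hX e.1.1 e.1.2]; ring

theorem sum_symmCoeff_sq_le {n : ℕ} (C : Fin n → Fin n → ℝ) :
    ∑ e, symmCoeff C e ^ 2 ≤ 2 * ∑ i, ∑ j, C i j ^ 2 := by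
  rw [← sum_symmCoeff fun i j => C i j ^ 2, Finset.mul_sum]
  refine Finset.sum_le_sum fun e _ => ?_
  unfold symmCoeff
  split_ifs with h
  · nlinarith [sq_nonneg (C e.1.1 e.1.1)]
  · nlinarith [sq_nonneg (C e.1.1 e.1.2 - C e.1.2 e.1.1)]

/-! ### Concentration for linear statistics of the graph -/

namespace IsRandomWeightedGraph

variable {Ω : Type*} [MeasurableSpace Ω] {μ : Measure Ω} {n : ℕ}
  {P W : Matrix (Fin n) (Fin n) ℝ} {A : Ω → Matrix (Fin n) (Fin n) ℝ}

theorem expectedMatrix_apply (h : IsRandomWeightedGraph μ P W A)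
    (hP0 : ∀ i j, 0 ≤ P i j) (hP1 : ∀ i j, P i j ≤ 1) {i j : Fin n} (hij : i ≤ j) :
    expectedMatrix μ A i j = P i j * W i j := by
  have := integral_comp_of_two_point_law (f := id) (h.measurable i j) (hP0 i j) (hP1 i j)
    (h.law i j hij) measurable_id
  simpa [expectedMatrix] using this

theorem expectedMatrix_symm (h : IsRandomWeightedGraph μ P W A) (i j : Fin n) :
    expectedMatrix μ A j i = expectedMatrix μ A i j := by
  simp [expectedMatrix, h.symm _ i j]

variable [IsProbabilityMeasure μ] {p w : ℝ}

theorem integrable_exp_mul_sub (h : IsRandomWeightedGraph μ P W A) (hW0 : ∀ i j, 0 ≤ W i j)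
    (e : {e : Fin n × Fin n // e.1 ≤ e.2}) (r m : ℝ) :
    Integrable (fun ω => Real.exp (r * (A ω e.1.1 e.1.2 - m))) μ := by
  have hm := h.measurable e.1.1 e.1.2
  have := integrable_exp_mul_of_mem_Icc (t := r) hm.aemeasurable
    (ae_mem_Icc_of_two_point_law hm (hW0 _ _) (h.law _ _ e.2))
  refine (this.mul_const (Real.exp (-(r * m)))).congr (ae_of_all _ fun ω => ?_)
  simp only [← Real.exp_add]
  ring_nf

theorem measureReal_sum_ge_le (h : IsRandomWeightedGraph μ P W A) (hW0 : ∀ i j, 0 ≤ W i j)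
    (c v : {e : Fin n × Fin n // e.1 ≤ e.2} → ℝ) {s : ℝ} (hs : 0 ≤ s)
    (hv : ∀ e : {e : Fin n × Fin n // e.1 ≤ e.2},
      mgf (fun ω => A ω e.1.1 e.1.2 - expectedMatrix μ A e.1.1 e.1.2) μ (c e * s) ≤
        Real.exp (v e)) (t : ℝ) :
    μ.real {ω | t ≤ ∑ e : {e : Fin n × Fin n // e.1 ≤ e.2},
      c e * (A ω e.1.1 e.1.2 - expectedMatrix μ A e.1.1 e.1.2)} ≤
      Real.exp (-s * t + ∑ e, v e) := by
  refine measureReal_sum_ge_le_exp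
    (Z := fun e ω => c e * (A ω e.1.1 e.1.2 - expectedMatrix μ A e.1.1 e.1.2)) ?_ ?_ hs ?_ ?_ t
  · exact h.indep.comp (fun e x => c e * (x - expectedMatrix μ A e.1.1 e.1.2)) fun e => by fun_prop
  · exact fun e => ((h.measurable _ _).sub_const _).const_mul _
  · intro e
    have := h.integrable_exp_mul_sub hW0 e (s * c e) (expectedMatrix μ A e.1.1 e.1.2)
    simpa only [mul_assoc] using this
  · intro e
    rw [mgf_const_mul]
    exact hv e

/-- Chernoff bound with the Bernstein variance proxy, for bounded coefficients. -/
theorem measureReal_sum_ge_le_of_abs_le_one (h : IsRandomWeightedGraph μ P W A)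
    (hP0 : ∀ i j, 0 ≤ P i j) (hPp : ∀ i j, P i j ≤ p) (hp1 : p ≤ 1)
    (hW0 : ∀ i j, 0 ≤ W i j) (hWw : ∀ i j, W i j ≤ w)
    (c : {e : Fin n × Fin n // e.1 ≤ e.2} → ℝ) (hc : ∀ e, |c e| ≤ 1)
    {s : ℝ} (hs : 0 ≤ s) (hsw : s * w ≤ 1) (t : ℝ) :
    μ.real {ω | t ≤ ∑ e : {e : Fin n × Fin n // e.1 ≤ e.2},
      c e * (A ω e.1.1 e.1.2 - expectedMatrix μ A e.1.1 e.1.2)} ≤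
      Real.exp (-s * t + p * (s * w) ^ 2 * ∑ e, |c e|) := by
  rw [Finset.mul_sum]
  refine h.measureReal_sum_ge_le hW0 c (fun e => p * (s * w) ^ 2 * |c e|) hs (fun e => ?_) t
  have hW := hW0 e.1.1 e.1.2
  have hWle := hWw e.1.1 e.1.2
  have hP := hP0 e.1.1 e.1.2
  have hsW : s * W e.1.1 e.1.2 ≤ s * w := mul_le_mul_of_nonneg_left hWle hs
  have hsW0 : 0 ≤ s * W e.1.1 e.1.2 := mul_nonneg hs hW
  have habs : |c e * s * W e.1.1 e.1.2| = |c e| * (s * W e.1.1 e.1.2) := by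
    rw [mul_assoc, abs_mul, abs_of_nonneg hsW0]
  rw [h.expectedMatrix_apply hP0 (fun i j => (hPp i j).trans hp1) e.2]
  refine (mgf_sub_mean_le_of_two_point_law (h.measurable _ _) hP ((hPp _ _).trans hp1)
    (h.law _ _ e.2) ?_).trans (Real.exp_le_exp.mpr ?_)
  · rw [habs]
    exact mul_le_one₀ (hc e) hsW0 (hsW.trans hsw)
  · rw [← sq_abs, habs, mul_pow]
    -- Bounding the square by the absolute value leaves only Σ|c e| to compute, which is n for a
    -- degree.
    have h1 : |c e| ^ 2 ≤ |c e| := by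
      rw [sq]; exact mul_le_of_le_one_left (abs_nonneg _) (hc e)
    have h2 : (s * W e.1.1 e.1.2) ^ 2 ≤ (s * w) ^ 2 := pow_le_pow_left₀ hsW0 hsW 2
    calc _ ≤ p * (|c e| * (s * w) ^ 2) := by
          refine mul_le_mul (hPp _ _) (mul_le_mul h1 h2 (sq_nonneg _) (abs_nonneg _)) ?_
            (hP.trans (hPp _ _))
          positivity
      _ = _ := by ring

/-- Hoeffding bound. -/
theorem measureReal_sum_ge_le_of_sum_sq_le (h : IsRandomWeightedGraph μ P W A)
    (hW0 : ∀ i j, 0 ≤ W i j) (hWw : ∀ i j, W i j ≤ w) (hw : 0 < w)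
    (c : {e : Fin n × Fin n // e.1 ≤ e.2} → ℝ) (hc : ∑ e, c e ^ 2 ≤ 2) {t : ℝ} (ht : 0 ≤ t) :
    μ.real {ω | t ≤ ∑ e : {e : Fin n × Fin n // e.1 ≤ e.2},
      c e * (A ω e.1.1 e.1.2 - expectedMatrix μ A e.1.1 e.1.2)} ≤ Real.exp (-(t / w) ^ 2) := by
  -- This s minimises −st + s²w²/4, the Hoeffding exponent when Σ c² = 2.
  have hs : 0 ≤ 2 * t / w ^ 2 := by positivity
  refine (h.measureReal_sum_ge_le hW0 c (fun e => (w / 2) ^ 2 * (2 * t / w ^ 2) ^ 2 / 2 * c e ^ 2)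
    hs (fun e => ?_) t).trans (Real.exp_le_exp.mpr ?_)
  · have hm := h.measurable e.1.1 e.1.2
    have hsub := hasSubgaussianMGF_of_mem_Icc hm.aemeasurable
      ((ae_mem_Icc_of_two_point_law hm (hW0 _ _) (h.law _ _ e.2)).mono fun ω hω =>
        (⟨hω.1, hω.2.trans (hWw _ _)⟩ : A ω e.1.1 e.1.2 ∈ Set.Icc 0 w))
    refine (hsub.mgf_le (c e * (2 * t / w ^ 2))).trans (Real.exp_le_exp.mpr (le_of_eq ?_))
    have : |w| = w := abs_of_pos hw
    simp only [sub_zero, NNReal.coe_pow, NNReal.coe_div, coe_nnnorm, Real.norm_eq_abs, this,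
      NNReal.coe_ofNat]
    ring
  · rw [← Finset.mul_sum]
    have h1 : (w / 2) ^ 2 * (2 * t / w ^ 2) ^ 2 / 2 * ∑ e, c e ^ 2 ≤
        (w / 2) ^ 2 * (2 * t / w ^ 2) ^ 2 / 2 * 2 :=
      mul_le_mul_of_nonneg_left hc (by positivity)
    refine (add_le_add_right h1 _).trans (le_of_eq ?_)
    field_simp
    ring

end IsRandomWeightedGraph

/-! ### Degrees, bilinear forms and closeness of the Laplacians -/

namespace IsRandomWeightedGraph

variable {Ω : Type*} [MeasurableSpace Ω] {μ : Measure Ω} {n : ℕ}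
  {P W : Matrix (Fin n) (Fin n) ℝ} {A : Ω → Matrix (Fin n) (Fin n) ℝ}

theorem sum_symmCoeff_mul_sub (h : IsRandomWeightedGraph μ P W A) (C : Fin n → Fin n → ℝ) (ω : Ω) :
    ∑ e, symmCoeff C e * (A ω e.1.1 e.1.2 - expectedMatrix μ A e.1.1 e.1.2) =
      ∑ i, ∑ j, C i j * (A ω - expectedMatrix μ A) i j :=
  sum_symmCoeff_mul C (A ω - expectedMatrix μ A) fun i j => by
    simp [h.symm ω i j, h.expectedMatrix_symm i j]

variable [IsProbabilityMeasure μ] {p w : ℝ}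

theorem measureReal_degree_deviation_le (h : IsRandomWeightedGraph μ P W A)
    (hP0 : ∀ i j, 0 ≤ P i j) (hPp : ∀ i j, P i j ≤ p) (hp0 : 0 < p) (hp1 : p ≤ 1)
    (hW0 : ∀ i j, 0 ≤ W i j) (hWw : ∀ i j, W i j ≤ w) (hw : 0 < w) (hn : 0 < n) {l : ℝ}
    (hl0 : 0 ≤ l) (hl : l ≤ n * p) (k : Fin n) :
    μ.real {ω | 2 * w * √(n * p * l) ≤ |((A ω - expectedMatrix μ A) *ᵥ 1) k|} ≤
      2 * Real.exp (-l) := by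
  set C : Fin n → Fin n → ℝ := fun i _ => if i = k then 1 else 0 with hC
  have hnR : (0 : ℝ) < n := by exact_mod_cast hn
  have hdeg : ∀ ω, ∑ e, symmCoeff C e * (A ω e.1.1 e.1.2 - expectedMatrix μ A e.1.1 e.1.2) =
      ((A ω - expectedMatrix μ A) *ᵥ 1) k := fun ω => by
    rw [h.sum_symmCoeff_mul_sub, Finset.sum_eq_single k]
    · simp [hC, Matrix.mulVec, dotProduct]
    · intro i _ hi
      simp [hC, hi]
    · simp
  have hC0 : ∀ e, 0 ≤ symmCoeff C e := fun e => by
    simp only [symmCoeff, hC]; split_ifs <;> norm_num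
  have hC1 : ∀ e, symmCoeff C e ≤ 1 := fun e => by
    simp only [symmCoeff, hC]
    split_ifs with h1 h2 h3 h4 <;> norm_num
    exact h1 (h3.trans h4.symm)
  have hsum : ∑ e, |symmCoeff C e| = n := by
    rw [Finset.sum_congr rfl fun e _ => abs_of_nonneg (hC0 e), sum_symmCoeff]
    simp [hC]
  -- This minimises the Chernoff exponent, whose two terms become −2l and l. The condition l ≤ np is
  -- exactly s w ≤ 1.
  set s := √(l / (n * p)) / w with hs
  have hsw : s * w = √(l / (n * p)) := div_mul_cancel₀ _ hw.ne'
  have hsw1 : s * w ≤ 1 := by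
    rw [hsw, Real.sqrt_le_one, div_le_one (by positivity)]
    exact hl
  have hexp : -s * (2 * w * √(n * p * l)) + p * (s * w) ^ 2 * n = -l := by
    have h1 : s * w * √(n * p * l) = l := by
      rw [hsw, ← Real.sqrt_mul (by positivity), show l / (n * p) * (n * p * l) = l ^ 2 by
        field_simp, Real.sqrt_sq hl0]
    have h2 : p * (s * w) ^ 2 * n = l := by
      rw [hsw, Real.sq_sqrt (by positivity)]
      field_simp
    linear_combination -2 * h1 + h2
  have htail : ∀ c : {e : Fin n × Fin n // e.1 ≤ e.2} → ℝ, (∀ e, |c e| = |symmCoeff C e|) →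
      μ.real {ω | 2 * w * √(n * p * l) ≤ ∑ e : {e : Fin n × Fin n // e.1 ≤ e.2},
        c e * (A ω e.1.1 e.1.2 - expectedMatrix μ A e.1.1 e.1.2)} ≤ Real.exp (-l) := by
    intro c hc
    have := h.measureReal_sum_ge_le_of_abs_le_one hP0 hPp hp1 hW0 hWw c
      (fun e => by rw [hc, abs_of_nonneg (hC0 e)]; exact hC1 e) (s := s) (by positivity) hsw1
      (2 * w * √(n * p * l))
    simpa only [hc, hsum, hexp] using this
  have h1 := htail (symmCoeff C) fun _ => rfl
  have h2 := htail (fun e => -symmCoeff C e) fun _ => abs_neg _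
  simp only [neg_mul, Finset.sum_neg_distrib, hdeg] at h1 h2
  refine (measureReal_mono (fun ω hω => ?_) (measure_ne_top _ _)).trans
    ((measureReal_union_le _ _).trans ((add_le_add h1 h2).trans_eq (two_mul _).symm))
  exact le_abs.mp (Set.mem_ofPred_eq ▸ hω)

/-- The form has coefficients y_i x_j, whose squares sum to ‖x‖²‖y‖² ≤ 1; symmetrising at most
doubles this. -/
theorem measureReal_bilinear_ge_le (h : IsRandomWeightedGraph μ P W A)
    (hW0 : ∀ i j, 0 ≤ W i j) (hWw : ∀ i j, W i j ≤ w) (hw : 0 < w)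
    {x y : EuclideanSpace ℝ (Fin n)} (hx : ‖x‖ ≤ 1) (hy : ‖y‖ ≤ 1) {t : ℝ} (ht : 0 ≤ t) :
    μ.real {ω | t ≤ inner ℝ y (Matrix.toEuclideanCLM (𝕜 := ℝ) (A ω - expectedMatrix μ A) x)} ≤
      Real.exp (-(t / w) ^ 2) := by
  set C : Fin n → Fin n → ℝ := fun i j => y i * x j with hC
  have hform : ∀ ω, ∑ e, symmCoeff C e * (A ω e.1.1 e.1.2 - expectedMatrix μ A e.1.1 e.1.2) =
      inner ℝ y (Matrix.toEuclideanCLM (𝕜 := ℝ) (A ω - expectedMatrix μ A) x) := fun ω => by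
    rw [h.sum_symmCoeff_mul_sub, Matrix.inner_toEuclideanCLM]
    simp only [hC, dotProduct, Matrix.mulVec, Finset.mul_sum]
    exact Finset.sum_congr rfl fun i _ => Finset.sum_congr rfl fun j _ => by ring
  have hsq : ∑ e, symmCoeff C e ^ 2 ≤ 2 := by
    refine (sum_symmCoeff_sq_le C).trans ?_
    have : ∑ i, ∑ j, C i j ^ 2 = ‖y‖ ^ 2 * ‖x‖ ^ 2 := by
      rw [EuclideanSpace.real_norm_sq_eq, EuclideanSpace.real_norm_sq_eq, Finset.sum_mul_sum]
      simp only [hC, mul_pow]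
    rw [this]
    have := mul_le_one₀ (pow_le_one₀ (n := 2) (norm_nonneg y) hy) (sq_nonneg ‖x‖)
      (pow_le_one₀ (n := 2) (norm_nonneg x) hx)
    linarith
  simpa only [hform] using h.measureReal_sum_ge_le_of_sum_sq_le hW0 hWw hw (symmCoeff C) hsq ht

/-- With probability at least `1 - δ`, the Laplacian of a weighted random graph is close to its
expectation. -/
theorem le_measureReal_laplacian_close (h : IsRandomWeightedGraph μ P W A)
    (hP0 : ∀ i j, 0 ≤ P i j) (hPp : ∀ i j, P i j ≤ p) (hp0 : 0 < p) (hp1 : p ≤ 1)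
    (hW0 : ∀ i j, 0 ≤ W i j) (hWw : ∀ i j, W i j ≤ w) (hw : 0 < w) (hn : 0 < n) {δ : ℝ}
    (hδ0 : 0 < δ) (hδ1 : δ < 1) (hl : Real.log (4 * n / δ) ≤ n * p)
    (hl' : Real.log 25 + Real.log (2 / δ) ≤ p * Real.log (4 * n / δ)) :
    1 - δ ≤ μ.real {ω | ∀ x y : Fin n → ℝ,
      |y ⬝ᵥ (laplacian (A ω) - laplacian (expectedMatrix μ A)) *ᵥ x| ≤
        8 * w * √(n * p * Real.log (4 * n / δ)) * (√(x ⬝ᵥ x) * √(y ⬝ᵥ y))} := by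
  set l := Real.log (4 * n / δ) with hldef
  set R := √(n * p * l) with hR
  have hn1 : (1 : ℝ) ≤ n := by exact_mod_cast hn
  have hlog2 : 0 ≤ Real.log (2 / δ) := Real.log_nonneg (by rw [le_div_iff₀ hδ0]; linarith)
  have hl0 : 0 ≤ l := Real.log_nonneg (by rw [le_div_iff₀ hδ0]; linarith)
  obtain ⟨s, hscard, hs1, hsnet⟩ := exists_half_net (EuclideanSpace ℝ (Fin n))
  rw [finrank_euclideanSpace_fin] at hscard
  set B₁ : Fin n → Set Ω := fun k => {ω | 2 * w * R ≤ |((A ω - expectedMatrix μ A) *ᵥ 1) k|}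
    with hB₁
  -- The net argument multiplies 3/2 by 4; with the 2 from the degrees this makes the constant 8.
  set B₂ : EuclideanSpace ℝ (Fin n) × EuclideanSpace ℝ (Fin n) → Set Ω := fun z =>
    {ω | 3 / 2 * w * R ≤
      inner ℝ z.2 (Matrix.toEuclideanCLM (𝕜 := ℝ) (A ω - expectedMatrix μ A) z.1)} with hB₂
  set G := {ω | ∀ x y : Fin n → ℝ,
      |y ⬝ᵥ (laplacian (A ω) - laplacian (expectedMatrix μ A)) *ᵥ x| ≤
        8 * w * R * (√(x ⬝ᵥ x) * √(y ⬝ᵥ y))} with hG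
  -- Subadditivity over a cover of the whole space requires no measurability of G.
  have hcover : Set.univ ⊆ G ∪ ((⋃ k, B₁ k) ∪ ⋃ z ∈ s ×ˢ s, B₂ z) := by
    intro ω _
    by_contra hω
    simp only [Set.mem_union, Set.mem_iUnion, not_or, not_exists] at hω
    obtain ⟨h1, h2, h3⟩ := hω
    refine h1 fun x y => ?_
    have hdeg : ∀ i, |((A ω - expectedMatrix μ A) *ᵥ 1) i| ≤ 2 * w * R := fun i =>
      (not_le.mp (h2 i)).le
    have hop := opNorm_le_of_half_net (s := (s : Set (EuclideanSpace ℝ (Fin n))))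
      (by simpa using hsnet)
      (Matrix.toEuclideanCLM (𝕜 := ℝ) (A ω - expectedMatrix μ A)) (t := 3 / 2 * w * R)
      fun x hx y hy => (not_le.mp (h3 (x, y) (Finset.mk_mem_product hx hy))).le
    refine (abs_dotProduct_laplacian_sub_le _ _ (by positivity) hdeg hop x y).trans (le_of_eq ?_)
    ring
  have hδ4 : Real.exp (-l) = δ / (4 * n) := by
    rw [hldef, Real.exp_neg, Real.exp_log (by positivity), inv_div]
  have hb1 : μ.real (⋃ k, B₁ k) ≤ δ / 2 := by
    refine (measureReal_iUnion_fintype_le _).trans ((Finset.sum_le_sum fun k _ =>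
      h.measureReal_degree_deviation_le hP0 hPp hp0 hp1 hW0 hWw hw hn hl0 hl k).trans_eq ?_)
    rw [hδ4]
    simp only [Finset.sum_const, Finset.card_univ, Fintype.card_fin, nsmul_eq_mul]
    field_simp
    norm_num
  have hb2 : μ.real (⋃ z ∈ s ×ˢ s, B₂ z) ≤ δ / 2 := by
    -- There are at most 5ⁿ · 5ⁿ = 25ⁿ pairs of net points, so each may fail with probability 25⁻ⁿ
    -- δ/2.
    have hexp : Real.exp (-(3 / 2 * w * R / w) ^ 2) ≤ (25 ^ n)⁻¹ * (δ / 2) := by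
      have h25 : (25 ^ n)⁻¹ * (δ / 2) = Real.exp (-(n * Real.log 25 + Real.log (2 / δ))) := by
        rw [Real.exp_neg, Real.exp_add, Real.exp_log (by positivity), mul_comm (n : ℝ),
          Real.exp_mul, Real.exp_log (by norm_num), Real.rpow_natCast, mul_inv, inv_div]
      rw [h25, Real.exp_le_exp, neg_le_neg_iff]
      have h1 : (3 / 2 * w * R / w) ^ 2 = 9 / 4 * (n * (p * l)) := by
        have : R ^ 2 = n * p * l := Real.sq_sqrt (by positivity)
        rw [show 3 / 2 * w * R / w = 3 / 2 * R by field_simp, mul_pow, this]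
        ring
      rw [h1]
      have h2 := mul_le_mul_of_nonneg_left hl' (Nat.cast_nonneg (α := ℝ) n)
      have h3 := mul_le_mul_of_nonneg_right hn1 hlog2
      have h4 : 0 ≤ n * (p * l) := by positivity
      linarith
    refine (measureReal_biUnion_finset_le _ _).trans ((Finset.sum_le_card_nsmul _ _
      ((25 ^ n)⁻¹ * (δ / 2)) fun z hz => ?_).trans ?_)
    · rw [Finset.mem_product] at hz
      exact (h.measureReal_bilinear_ge_le hW0 hWw hw (hs1 _ hz.1) (hs1 _ hz.2)
        (by positivity)).trans hexp
    · rw [Finset.card_product, nsmul_eq_mul]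
      have hc : ((s.card * s.card : ℕ) : ℝ) ≤ 25 ^ n := by
        have := Nat.mul_le_mul hscard hscard
        rw [← mul_pow] at this
        exact_mod_cast this
      calc _ ≤ (25 : ℝ) ^ n * ((25 ^ n)⁻¹ * (δ / 2)) :=
            mul_le_mul_of_nonneg_right hc (by positivity)
        _ = δ / 2 := mul_inv_cancel_left₀ (by positivity) _
  have h1 := (measureReal_mono hcover (measure_ne_top μ _)).trans (measureReal_union_le _ _)
  rw [probReal_univ] at h1
  have h2 := measureReal_union_le (μ := μ) (⋃ k, B₁ k) (⋃ z ∈ s ×ˢ s, B₂ z)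
  linarith

end IsRandomWeightedGraph

/-! ### Large n and the final assembly -/

/-- For fixed p and δ, log n is o(n) and tends to infinity. The first condition serves the degree
bound, the second the union over the net. -/
theorem eventually_log_le_and_le_mul_log {p δ : ℝ} (hp : 0 < p) (hδ : 0 < δ) (C : ℝ) :
    ∀ᶠ n : ℕ in Filter.atTop,
      Real.log (4 * n / δ) ≤ n * p ∧ C ≤ p * Real.log (4 * n / δ) := by
  have hlin : Filter.Tendsto (fun n : ℕ => 4 * (n : ℝ) / δ) Filter.atTop Filter.atTop :=
    (tendsto_natCast_atTop_atTop.const_mul_atTop (by norm_num : (0 : ℝ) < 4)).atTop_div_const hδ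
  have h1 := hlin.eventually (Real.isLittleO_log_id_atTop.def (show 0 < p * δ / 4 by positivity))
  have h2 := ((Real.tendsto_log_atTop.comp hlin).const_mul_atTop hp).eventually_ge_atTop C
  filter_upwards [h1, h2] with n hn1 hn2
  refine ⟨(le_abs_self _).trans (hn1.trans_eq ?_), hn2⟩
  rw [id, Real.norm_of_nonneg (by positivity)]
  field_simp

theorem twoBlock_induction {n : ℕ} (Ia : Finset (Fin n)) {x y : ℝ} {motive : ℝ → Prop}
    (hx : motive x) (hy : motive y) (i j : Fin n) : motive (twoBlock Ia x y i j) := by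
  simp only [twoBlock, Matrix.of_apply]
  split_ifs <;> assumption

theorem IsRandomWeightedGraph.expectedMatrix_eq_twoBlock {Ω : Type*} [MeasurableSpace Ω]
    {μ : Measure Ω} {n : ℕ} {Ia : Finset (Fin n)} {p q wp wq : ℝ}
    {A : Ω → Matrix (Fin n) (Fin n) ℝ}
    (h : IsRandomWeightedGraph μ (twoBlock Ia p q) (twoBlock Ia wp wq) A)
    (hp0 : 0 ≤ p) (hp1 : p ≤ 1) (hq0 : 0 ≤ q) (hq1 : q ≤ 1) :
    expectedMatrix μ A = twoBlock Ia (p * wp) (q * wq) := by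
  have hle : ∀ i j : Fin n, i ≤ j →
      expectedMatrix μ A i j = twoBlock Ia (p * wp) (q * wq) i j := by
    intro i j hij
    rw [h.expectedMatrix_apply (twoBlock_induction Ia hp0 hq0)
      (twoBlock_induction (motive := (· ≤ 1)) Ia hp1 hq1) hij]
    simp only [twoBlock, Matrix.of_apply]
    split_ifs <;> rfl
  ext i j
  rcases le_total i j with hij | hij
  · exact hle i j hij
  · rw [h.expectedMatrix_symm j i, hle j i hij]
    simp [twoBlock, iff_comm]

theorem theorem3 (p q wp wq γ : ℝ) (hq : 0 ≤ q) (hqp : q < p) (hp : p ≤ 1)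
    (hγ0 : 0 < γ) (hγ1 : γ < 1) (hwp : 0 < wp) (hwq : wq = γ * wp)
    (c : ℝ) (hc : 0 < c) (δ : ℝ) (hδ0 : 0 < δ) (hδ1 : δ < 1) :
    ∃ N : ℕ, ∀ n : ℕ, N ≤ n → ∀ Ia Ib : Finset (Fin n),
      c * (n : ℝ) ≤ ((min Ia.card Ib.card : ℕ) : ℝ) →
      ∀ (Ω : Type*) [MeasurableSpace Ω] (μ : Measure Ω) [IsProbabilityMeasure μ]
        (A : Ω → Matrix (Fin n) (Fin n) ℝ), IsWSBM μ Ia Ib p q wp wq A →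
      1 - δ ≤ μ.real {ω |
        wp * (p + γ * q) * ((min Ia.card Ib.card : ℕ) : ℝ)
            - 8 * wp * Real.sqrt ((n : ℝ) * p * Real.log (4 * (n : ℝ) / δ))
          ≤ kthEigenvalue (laplacian (A ω)) 3 ∧
        ∀ u v : Fin n → ℝ, IsSecondEigenvector (laplacian (A ω)) u →
          IsSecondEigenvector (laplacian (expectedMatrix μ A)) v →
          sinAngle u v ≤ 16 * Real.sqrt 2 / (p - γ * q) *
            Real.sqrt ((n : ℝ) * p * Real.log (4 * (n : ℝ) / δ)
              / ((min Ia.card Ib.card : ℕ) : ℝ) ^ 2)} := by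
  have hp0 : 0 < p := by linarith
  have hwq0 : 0 ≤ wq := by rw [hwq]; positivity
  have hwqp : wq ≤ wp := by rw [hwq]; exact mul_le_of_le_one_left hwp.le hγ1.le
  have hγq : γ * q < p := (mul_le_of_le_one_left hq hγ1.le).trans_lt hqp
  obtain ⟨N, hN⟩ := Filter.eventually_atTop.mp
    (eventually_log_le_and_le_mul_log hp0 hδ0 (Real.log 25 + Real.log (2 / δ)))
  -- The 3 keeps λ₃ in range, away from the default value 0 of `kthEigenvalue`.
  refine ⟨max N 3, fun n hn Ia Ib hmin Ω _ μ _ A hA => ?_⟩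
  have hn3 : 2 < n := (le_max_right _ _).trans hn
  have hnR : (0 : ℝ) < n := by exact_mod_cast (by omega : 0 < n)
  obtain ⟨hl1, hl2⟩ := hN n ((le_max_left _ _).trans hn)
  have hm0 : 0 < ((min Ia.card Ib.card : ℕ) : ℝ) := (mul_pos hc hnR).trans_le hmin
  have hm : 0 < min Ia.card Ib.card := by exact_mod_cast hm0
  have hclose := hA.graph.le_measureReal_laplacian_close
    (twoBlock_induction Ia hp0.le hq) (twoBlock_induction (motive := (· ≤ p)) Ia le_rfl hqp.le)
    hp0 hp (twoBlock_induction Ia hwp.le hwq0)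
    (twoBlock_induction (motive := (· ≤ wp)) Ia le_rfl hwqp) hwp (by omega) hδ0 hδ1 hl1 hl2
  rw [hA.graph.expectedMatrix_eq_twoBlock hp0.le hp hq (by linarith)] at hclose ⊢
  set l := Real.log (4 * n / δ)
  set m := ((min Ia.card Ib.card : ℕ) : ℝ) with hmdef
  have hb : 0 ≤ q * wq := mul_nonneg hq hwq0
  have hgap : p * wp - q * wq = wp * (p - γ * q) := by rw [hwq]; ring
  have hgap0 : 0 < wp * (p - γ * q) := mul_pos hwp (by linarith)
  have hab : q * wq < p * wp := by linarith
  refine hclose.trans (measureReal_mono (fun ω hω => ⟨?_, fun u v hu hv => ?_⟩)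
    (measure_ne_top _ _))
  · have h3 := le_kthEigenvalue_three_of_close hA.partition hn3 hab.le
      (laplacian_isHermitian (hA.graph.symm ω)) hω
    -- This turns nb + (a − b)m into at least (a + b)m = w_p(p + γq)m.
    have h2m : 2 * m ≤ n := by
      rw [← card_add_card_of_isCompl hA.partition, hmdef, two_mul]
      exact add_le_add (by exact_mod_cast min_le_left _ _) (by exact_mod_cast min_le_right _ _)
    have h4 := mul_le_mul_of_nonneg_right h2m hb
    have h5 : wp * (p + γ * q) * m = 2 * m * (q * wq) + (p * wp - q * wq) * m := by
      rw [hwq]; ring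
    rw [h5]
    linarith
  · refine (sinAngle_le_of_close hA.partition (by omega) hm hb hab
      (laplacian_isHermitian (hA.graph.symm ω)) hω hu hv).trans ?_
    rw [hgap, Real.sqrt_div' _ (sq_nonneg m), Real.sqrt_sq hm0.le]
    have h1 : 2 * (8 * wp * √(n * p * l)) / (wp * (p - γ * q) * m) =
        16 / (p - γ * q) * (√(n * p * l) / m) := by
      have : p - γ * q ≠ 0 := by linarith
      field_simp
      ring
    rw [h1]
    -- The argument yields the constant 16; the factor √2 is slack.
    have h2 : (1 : ℝ) ≤ √2 := by rw [Real.one_le_sqrt]; norm_num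
    have h3 : 0 < p - γ * q := by linarith
    gcongr
    linarith
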